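/- Let $G=(S,E)$ be a finite simple undirected graph in which no vertex has degree $0$, let $K\subset\mathbb{C}$ be a field and let $c>1$ be an integer. Let $\mathfrak{f}^K(S)$ be the free Lie algebra over $K$ on $S$, let $I_G$ be its ideal generated by all brackets $[\alpha,\beta]$ with $\alpha,\beta\in S$ and $\{\alpha,\beta\}\notin E$, put $\mathfrak{g}=\mathfrak{f}^K(S)/I_G$, and let $\mathfrak{n}=\mathfrak{n}_{G,c}^K=\mathfrak{g}/\gamma_{c+1}(\mathfrak{g})$, where $\gamma_1(\mathfrak{g})=\mathfrak{g}$ and $\gamma_{i+1}(\mathfrak{g})=[\mathfrak{g},\gamma_i(\mathfrak{g})]$. Let $\pi_{\mathrm{ab}}:\mathfrak{n}\to\mathfrak{n}/[\mathfrak{n},\mathfrak{n}]$ be the projection onto the abelianization, where $\mathfrak{n}/[\mathfrak{n},\mathfrak{n}]$ is identified with the span $V=\mathrm{span}_K(S)$ of the vertices in $\mathfrak n$ via $v\mapsto v+[\mathfrak{n},\mathfrak{n}]$. Call a Lie algebra indecomposable if it is not the direct sum of two nonzero ideals. Let $\mathfrak{h}_1,\ldots,\mathfrak{h}_k\subset\mathfrak{n}$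 be nonzero ideals, each indecomposable as a Lie algebra, such that $\mathfrak{n}=\mathfrak{h}_1\oplus\cdots\oplus\mathfrak{h}_k$. Then $k$ equals the number of connected components of $G$, and the connected components can be ordered as $C_1,\ldots,C_k$ in such a way that $\pi_{\mathrm{ab}}(\mathfrak{h}_i)=\mathrm{span}_K(C_i)$ for all $i\in\{1,\ldots,k\}$. -/

import Mathlib

/-- A Lie algebra is *decomposable* if it is the (internal) direct sum of two nonzero ideals. -/
def LieDecomposable (K L : Type*) [CommRing K] [LieRing L] [LieAlgebra K L] : Prop :=
  ∃ I J : LieIdeal K L, I ≠ ⊥ ∧ J ≠ ⊥ ∧ IsCompl I J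

section GraphLie

variable (K : Type*) [CommRing K] {S : Type*} (G : SimpleGraph S)

/-- The ideal of the free Lie algebra on the vertices generated by the brackets `⁅α, β⁆` of all
pairs of vertices that are not joined by an edge. -/
noncomputable def graphIdeal : LieIdeal K (FreeLieAlgebra K S) :=
  LieSubmodule.lieSpan K (FreeLieAlgebra K S)
    {x | ∃ α β : S, ¬ G.Adj α β ∧ x = ⁅FreeLieAlgebra.of K α, FreeLieAlgebra.of K β⁆}

/-- The Lie algebra associated to a graph. -/
abbrev GraphLie : Type _ := FreeLieAlgebra K S ⧸ graphIdeal K G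

/-- The ideal `γ_{c+1}` of the Lie algebra of a graph, where `γ_1` is the whole Lie algebra and
`γ_{i+1} = [𝔤, γ_i]`. Mathlib's lower central series starts at index `0`. -/
noncomputable abbrev graphGamma (c : ℕ) : LieIdeal K (GraphLie K G) :=
  LieModule.lowerCentralSeries K (GraphLie K G) (GraphLie K G) c

/-- The `c`-step nilpotent Lie algebra associated to a graph. -/
abbrev NilGraphLie (c : ℕ) : Type _ := GraphLie K G ⧸ graphGamma K G c

/-- A vertex, as an element of the `c`-step nilpotent Lie algebra of the graph. -/
noncomputable def nilVertex (c : ℕ) (α : S) : NilGraphLie K G c :=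
  LieSubmodule.Quotient.mk' (graphGamma K G c)
    (LieSubmodule.Quotient.mk' (graphIdeal K G) (FreeLieAlgebra.of K α))

/-- The linear span of a set of vertices in the `c`-step nilpotent Lie algebra of the graph. -/
noncomputable def nilVertexSpan (c : ℕ) (T : Set S) : Submodule K (NilGraphLie K G c) :=
  Submodule.span K (nilVertex K G c '' T)

end GraphLie

/-- The quotient map of a Lie algebra onto its abelianization `L / [L, L]`, as a linear map. -/
noncomputable def abProj (K L : Type*) [CommRing K] [LieRing L] [LieAlgebra K L] :
    L →ₗ[K] L ⧸ ⁅(⊤ : LieIdeal K L), (⊤ : LieIdeal K L)⁆ :=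
  (LieSubmodule.Quotient.mk' ⁅(⊤ : LieIdeal K L), (⊤ : LieIdeal K L)⁆ : L →ₗ[K] _)

/-! Mapping to the two-step model `TwoStep` gives linear coordinates dual to the vertices
(`NilGraphLie.exists_coord`): they kill brackets, and two commuting elements have proportional
coordinate pairs at every edge. Distinct summands commute, so two of them cannot both be visible at
the ends of one edge. As every vertex has a neighbour, each vertex belongs to exactly one summand,
constantly along edges (`NilGraphLie.exists_support`). This gives a map from components to summands.

It is onto because a summand with no vertex lies in the derived ideal, and nilpotency forces it to
be zero (`LieIdeal.eq_bot_of_isCompl_of_le`). It is injective because a summand owning two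
components decomposes (`NilGraphLie.lieDecomposable_of_split`): replacing each vertex by its
component in the summand that owns it defines an automorphism, which carries the splitting along
components into the summand. Bijectivity there, and the vanishing above, both rest on
`LieHom.bijective_of_sub_self_mem`. -/

/-! ### Endomorphisms that are the identity on the abelianization. -/

section Unipotent

variable {K L : Type*} [CommRing K] [LieRing L] [LieAlgebra K L]

/-- A Lie algebra endomorphism which induces the identity on the abelianization induces the
identity on all quotients of the lower central series. -/
theorem LieHom.sub_self_mem_lowerCentralSeries (θ : L →ₗ⁅K⁆ L)
    (hθ : ∀ x, θ x - x ∈ ⁅(⊤ : LieIdeal K L), (⊤ : LieIdeal K L)⁆) (m : ℕ) :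
    ∀ x ∈ LieModule.lowerCentralSeries K L L m,
      θ x - x ∈ LieModule.lowerCentralSeries K L L (m + 1) := by
  induction m with
  | zero => intro x _; simpa [LieModule.lowerCentralSeries_succ] using hθ x
  | succ m ih =>
    -- By Jacobi, bracketing with a derived element moves two stages down the series, not one.
    have key : ∀ u ∈ ⁅(⊤ : LieIdeal K L), (⊤ : LieIdeal K L)⁆,
        ∀ y ∈ LieModule.lowerCentralSeries K L L m,
          ⁅u, y⁆ ∈ LieModule.lowerCentralSeries K L L (m + 2) := by
      intro u hu y hy
      rw [← LieSubmodule.mem_toSubmodule, LieSubmodule.lieIdeal_oper_eq_linear_span'] at hu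
      induction hu using Submodule.span_induction with
      | mem u hu =>
        obtain ⟨a, -, b, -, rfl⟩ := hu
        rw [lie_lie]
        have h2 : ∀ a b : L, ⁅a, ⁅b, y⁆⁆ ∈ LieModule.lowerCentralSeries K L L (m + 2) := by
          intro a b
          rw [LieModule.lowerCentralSeries_succ, LieModule.lowerCentralSeries_succ]
          exact LieSubmodule.lie_mem_lie (LieSubmodule.mem_top _)
            (LieSubmodule.lie_mem_lie (LieSubmodule.mem_top _) hy)
        exact sub_mem (h2 a b) (h2 b a)
      | zero => simp
      | add u v _ _ h1 h2 => rw [add_lie]; exact add_mem h1 h2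
      | smul t u _ h1 => rw [smul_lie]; exact SMulMemClass.smul_mem t h1
    intro x hx
    rw [LieModule.lowerCentralSeries_succ, ← LieSubmodule.mem_toSubmodule,
      LieSubmodule.lieIdeal_oper_eq_linear_span'] at hx
    induction hx using Submodule.span_induction with
    | mem x hx =>
      obtain ⟨a, -, y, hy, rfl⟩ := hx
      have h1 := key _ (hθ a) y hy
      have h2 : ⁅θ a, θ y - y⁆ ∈ LieModule.lowerCentralSeries K L L (m + 2) := by
        rw [LieModule.lowerCentralSeries_succ]
        exact LieSubmodule.lie_mem_lie (LieSubmodule.mem_top _) (ih y hy)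
      have h3 : θ ⁅a, y⁆ - ⁅a, y⁆ = ⁅θ a, θ y - y⁆ + ⁅θ a - a, y⁆ := by
        rw [LieHom.map_lie, lie_sub, sub_lie]; abel
      rw [h3]
      exact add_mem h2 h1
    | zero => simp
    | add u v _ _ h1 h2 =>
      rw [map_add, add_sub_add_comm]; exact add_mem h1 h2
    | smul t u _ h1 => rw [map_smul, ← smul_sub]; exact SMulMemClass.smul_mem t h1

/-- An endomorphism of a nilpotent Lie algebra which induces the identity on the abelianization
is bijective. -/
theorem LieHom.bijective_of_sub_self_mem (θ : L →ₗ⁅K⁆ L)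
    (hθ : ∀ x, θ x - x ∈ ⁅(⊤ : LieIdeal K L), (⊤ : LieIdeal K L)⁆) {c : ℕ}
    (hc : LieModule.lowerCentralSeries K L L c = ⊥) : Function.Bijective θ := by
  have H := θ.sub_self_mem_lowerCentralSeries hθ
  constructor
  · rw [injective_iff_map_eq_zero]
    intro x hx
    -- If `θ x = 0`, then `θ x - x = -x`, so `x` sinks one stage at a time.
    have h1 : ∀ m, x ∈ LieModule.lowerCentralSeries K L L m := by
      intro m
      induction m with
      | zero => simp
      | succ m ih => simpa [hx] using H m x ih
    simpa [hc] using h1 c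
  -- Upward induction from the zero stage: if `x` maps to `θ y - y`, then `y - x` maps to `y`.
  · have h1 : ∀ m, m ≤ c → ∀ y ∈ LieModule.lowerCentralSeries K L L (c - m), ∃ x, θ x = y := by
      intro m
      induction m with
      | zero =>
        intro _ y hy
        rw [Nat.sub_zero, hc, LieSubmodule.mem_bot] at hy
        exact ⟨0, by simp [hy]⟩
      | succ m ih =>
        intro hm y hy
        have h2 := H _ y hy
        rw [show c - (m + 1) + 1 = c - m by omega] at h2
        obtain ⟨x, hx⟩ := ih (by omega) _ h2
        exact ⟨y - x, by rw [map_sub, hx]; abel⟩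
    intro y
    exact h1 c le_rfl y (by simp)

end Unipotent

/-! ### Quotient morphisms and generation of the free Lie algebra. -/

section QuotientHom

variable {K L L' : Type*} [CommRing K] [LieRing L] [LieAlgebra K L] [LieRing L'] [LieAlgebra K L']

/-- The quotient map of a Lie algebra by an ideal, as a morphism of Lie algebras. -/
def LieIdeal.quotientHom (I : LieIdeal K L) : L →ₗ⁅K⁆ L ⧸ I :=
  { (LieSubmodule.Quotient.mk' I : L →ₗ[K] L ⧸ I) with
    map_lie' := fun {_ _} => rfl }

theorem LieIdeal.quotientHom_surjective (I : LieIdeal K L) : Function.Surjective I.quotientHom :=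
  LieSubmodule.Quotient.surjective_mk' I

/-- A morphism of Lie algebras that vanishes on an ideal descends to the quotient. -/
def LieIdeal.quotientLift (I : LieIdeal K L) (f : L →ₗ⁅K⁆ L') (h : I ≤ f.ker) : L ⧸ I →ₗ⁅K⁆ L' :=
  { I.toSubmodule.liftQ (f : L →ₗ[K] L') (fun x hx => LieHom.mem_ker.1 (h hx)) with
    map_lie' := by
      intro x y
      obtain ⟨x, rfl⟩ := I.quotientHom_surjective x
      obtain ⟨y, rfl⟩ := I.quotientHom_surjective y
      exact f.map_lie x y }

/-- Lifting the generators into `H` and including back is the identity, by uniqueness of lifts. -/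
theorem FreeLieAlgebra.lieSubalgebra_eq_top {X : Type*} (H : LieSubalgebra K (FreeLieAlgebra K X))
    (h : ∀ x, FreeLieAlgebra.of K x ∈ H) : H = ⊤ := by
  have h1 : H.incl.comp (FreeLieAlgebra.lift K fun x => (⟨_, h x⟩ : H)) = LieHom.id := by
    apply FreeLieAlgebra.hom_ext
    intro x
    simp
  rw [eq_top_iff]
  intro x _
  have h2 := LieHom.congr_fun h1 x
  rw [LieHom.id_apply] at h2
  rw [← h2]
  exact SetLike.coe_mem (FreeLieAlgebra.lift K (fun x => (⟨_, h x⟩ : H)) x)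

end QuotientHom

/-! ### Universal property and generation by vertices. -/

section NilGraph

variable {K : Type*} [CommRing K] {S : Type*} {G : SimpleGraph S} {c : ℕ}

theorem NilGraphLie.lowerCentralSeries_eq_bot :
    LieModule.lowerCentralSeries K (NilGraphLie K G c) (NilGraphLie K G c) c = ⊥ := by
  rw [← LieIdeal.lowerCentralSeries_map_eq c (graphGamma K G c).quotientHom_surjective,
    LieIdeal.map_eq_bot_iff]
  intro x hx
  exact LieHom.mem_ker.2 (LieSubmodule.Quotient.mk_eq_zero'.2 hx)

/-- A morphism from the `c`-step nilpotent Lie algebra of a graph to another `c`-step nilpotent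
Lie algebra, given by its values on vertices. -/
theorem NilGraphLie.exists_lift {L : Type*} [LieRing L] [LieAlgebra K L]
    (hL : LieModule.lowerCentralSeries K L L c = ⊥) (φ : S → L)
    (hφ : ∀ α β, ¬ G.Adj α β → ⁅φ α, φ β⁆ = 0) :
    ∃ f : NilGraphLie K G c →ₗ⁅K⁆ L, ∀ α, f (nilVertex K G c α) = φ α := by
  have h1 : graphIdeal K G ≤ (FreeLieAlgebra.lift K φ).ker := by
    refine LieSubmodule.lieSpan_le.2 ?_
    rintro _ ⟨α, β, h, rfl⟩
    simpa [LieHom.mem_ker] using hφ α β h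
  let g : GraphLie K G →ₗ⁅K⁆ L := LieIdeal.quotientLift _ _ h1
  have h2 : graphGamma K G c ≤ g.ker := by
    rw [← LieIdeal.map_eq_bot_iff, eq_bot_iff, ← hL]
    exact LieIdeal.map_lowerCentralSeries_le c
  refine ⟨LieIdeal.quotientLift _ g h2, fun α => ?_⟩
  change FreeLieAlgebra.lift K φ (FreeLieAlgebra.of K α) = φ α
  simp

theorem NilGraphLie.induction {P : NilGraphLie K G c → Prop}
    (vertex : ∀ α, P (nilVertex K G c α)) (zero : P 0) (add : ∀ x y, P x → P y → P (x + y))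
    (smul : ∀ (t : K) x, P x → P (t • x)) (lie : ∀ x y, P x → P y → P ⁅x, y⁆)
    (x : NilGraphLie K G c) : P x := by
  let q : FreeLieAlgebra K S →ₗ⁅K⁆ NilGraphLie K G c :=
    (graphGamma K G c).quotientHom.comp (graphIdeal K G).quotientHom
  let H : LieSubalgebra K (FreeLieAlgebra K S) :=
    { carrier := {y | P (q y)}
      add_mem' := fun {a b} ha hb => by
        have := add _ _ ha hb
        rwa [← map_add] at this
      zero_mem' := by
        change P (q 0)
        rwa [map_zero]
      smul_mem' := fun t a ha => by
        have := smul t _ ha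
        rwa [← map_smul] at this
      lie_mem' := fun {a b} ha hb => by
        have := lie _ _ ha hb
        rwa [← LieHom.map_lie] at this }
  have hH : H = ⊤ := FreeLieAlgebra.lieSubalgebra_eq_top H vertex
  obtain ⟨y, rfl⟩ := (graphGamma K G c).quotientHom_surjective x
  obtain ⟨z, rfl⟩ := (graphIdeal K G).quotientHom_surjective y
  have : z ∈ H := hH ▸ LieSubalgebra.mem_top z
  exact this

theorem NilGraphLie.hom_ext {L : Type*} [LieRing L] [LieAlgebra K L]
    {f g : NilGraphLie K G c →ₗ⁅K⁆ L}
    (h : ∀ α, f (nilVertex K G c α) = g (nilVertex K G c α)) (x : NilGraphLie K G c) :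
    f x = g x := by
  induction x using NilGraphLie.induction with
  | vertex α => exact h α
  | zero => simp
  | add x y hx hy => rw [map_add, map_add, hx, hy]
  | smul t x hx => rw [map_smul, map_smul, hx]
  | lie x y hx hy => rw [LieHom.map_lie, LieHom.map_lie, hx, hy]

theorem nilVertex_lie_eq_zero {α β : S} (h : ¬ G.Adj α β) :
    ⁅nilVertex K G c α, nilVertex K G c β⁆ = 0 := by
  have h1 : (graphIdeal K G).quotientHom ⁅FreeLieAlgebra.of K α, FreeLieAlgebra.of K β⁆ = 0 :=
    LieSubmodule.Quotient.mk_eq_zero'.2 (LieSubmodule.subset_lieSpan ⟨α, β, h, rfl⟩)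
  have h2 := congrArg (graphGamma K G c).quotientHom h1
  rw [map_zero] at h2
  exact h2

/-- Checking vertices suffices: on a bracket both terms are already derived. -/
theorem NilGraphLie.sub_self_mem (θ : NilGraphLie K G c →ₗ⁅K⁆ NilGraphLie K G c)
    (h : ∀ α, θ (nilVertex K G c α) - nilVertex K G c α ∈
      ⁅(⊤ : LieIdeal K (NilGraphLie K G c)), (⊤ : LieIdeal K (NilGraphLie K G c))⁆)
    (x : NilGraphLie K G c) : θ x - x ∈
      ⁅(⊤ : LieIdeal K (NilGraphLie K G c)), (⊤ : LieIdeal K (NilGraphLie K G c))⁆ := by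
  induction x using NilGraphLie.induction with
  | vertex α => exact h α
  | zero => simp
  | add x y hx hy => rw [map_add, add_sub_add_comm]; exact add_mem hx hy
  | smul t x hx => rw [map_smul, ← smul_sub]; exact SMulMemClass.smul_mem t hx
  | lie x y hx hy =>
    rw [LieHom.map_lie]
    exact sub_mem (LieSubmodule.lie_mem_lie (LieSubmodule.mem_top _) (LieSubmodule.mem_top _))
      (LieSubmodule.lie_mem_lie (LieSubmodule.mem_top _) (LieSubmodule.mem_top _))

end NilGraph

/-! ### The two-step model. -/

section TwoStep

/-- The `2`-step nilpotent Lie algebra of functions on vertices and pairs of vertices, in which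
the bracket of `v` and `w` has the coordinate `v α * w β - v β * w α` at each edge `αβ`. -/
structure TwoStep (K : Type*) {S : Type*} (G : SimpleGraph S) where
  vert : S → K
  edge : S → S → K

namespace TwoStep

variable {K : Type*} {S : Type*} {G : SimpleGraph S}

/-- The underlying pair. -/
def toProd : TwoStep K G ≃ (S → K) × (S → S → K) where
  toFun x := (x.vert, x.edge)
  invFun x := ⟨x.1, x.2⟩

@[ext] theorem ext {x y : TwoStep K G} (h : ∀ α, x.vert α = y.vert α)
    (h' : ∀ α β, x.edge α β = y.edge α β) : x = y := by
  cases x; cases y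
  congr
  · exact funext h
  · exact funext fun α => funext (h' α)

variable [CommRing K]

noncomputable instance : AddCommGroup (TwoStep K G) := toProd.addCommGroup

noncomputable instance : Module K (TwoStep K G) := toProd.module K

@[simp] theorem vert_add (x y : TwoStep K G) (α : S) : (x + y).vert α = x.vert α + y.vert α := rfl
@[simp] theorem edge_add (x y : TwoStep K G) (α β : S) :
    (x + y).edge α β = x.edge α β + y.edge α β := rfl
@[simp] theorem vert_zero (α : S) : (0 : TwoStep K G).vert α = 0 := rfl
@[simp] theorem edge_zero (α β : S) : (0 : TwoStep K G).edge α β = 0 := rfl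
@[simp] theorem vert_smul (t : K) (x : TwoStep K G) (α : S) : (t • x).vert α = t * x.vert α := rfl
@[simp] theorem edge_smul (t : K) (x : TwoStep K G) (α β : S) :
    (t • x).edge α β = t * x.edge α β := rfl

open Classical in
noncomputable instance : Bracket (TwoStep K G) (TwoStep K G) where
  bracket x y := ⟨0, fun α β => if G.Adj α β then x.vert α * y.vert β - x.vert β * y.vert α else 0⟩

@[simp] theorem vert_lie (x y : TwoStep K G) (α : S) : ⁅x, y⁆.vert α = 0 := rfl

open Classical in
@[simp] theorem edge_lie (x y : TwoStep K G) (α β : S) : ⁅x, y⁆.edge α β =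
    if G.Adj α β then x.vert α * y.vert β - x.vert β * y.vert α else 0 := rfl

noncomputable instance : LieRing (TwoStep K G) where
  add_lie x y z := by
    ext α β
    · simp
    · simp only [edge_lie, edge_add, vert_add]; split_ifs <;> ring
  lie_add x y z := by
    ext α β
    · simp
    · simp only [edge_lie, edge_add, vert_add]; split_ifs <;> ring
  lie_self x := by
    ext α β
    · simp
    · simp only [edge_lie, edge_zero]; split_ifs <;> ring
  -- Brackets have no vertex part, so every double bracket vanishes.
  leibniz_lie x y z := by
    ext α β <;> simp

noncomputable instance : LieAlgebra K (TwoStep K G) where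
  lie_smul t x y := by
    ext α β
    · simp
    · simp only [edge_lie, edge_smul, vert_smul]; split_ifs <;> ring

theorem lowerCentralSeries_eq_bot {c : ℕ} (hc : 1 < c) :
    LieModule.lowerCentralSeries K (TwoStep K G) (TwoStep K G) c = ⊥ := by
  have h2 : LieModule.lowerCentralSeries K (TwoStep K G) (TwoStep K G) 2 = ⊥ := by
    rw [LieModule.lowerCentralSeries_succ, LieSubmodule.lie_eq_bot_iff]
    intro x _ y hy
    have hv : ∀ α, y.vert α = 0 := by
      rw [LieModule.lowerCentralSeries_succ, ← LieSubmodule.mem_toSubmodule,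
        LieSubmodule.lieIdeal_oper_eq_linear_span'] at hy
      induction hy using Submodule.span_induction with
      | mem y hy =>
        obtain ⟨a, -, b, -, rfl⟩ := hy
        simp
      | zero => simp
      | add u v _ _ h1 h2 => simp_all
      | smul t u _ h1 => simp_all
    ext α β <;> simp [hv]
  exact eq_bot_iff.2 (h2 ▸ LieModule.antitone_lowerCentralSeries K _ _ hc)

end TwoStep

end TwoStep

/-! ### Coordinates on the abelianization. -/

section Coordinates

variable {K : Type*} [CommRing K] {S : Type*} {G : SimpleGraph S} {c : ℕ}

/-- There are linear coordinates on the abelianization, dual to the vertices, and commuting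
elements have proportional coordinates at each edge. -/
theorem NilGraphLie.exists_coord [DecidableEq S] (hc : 1 < c) :
    ∃ coord : S → NilGraphLie K G c →ₗ[K] K,
      (∀ α β, coord α (nilVertex K G c β) = if α = β then 1 else 0) ∧
      (∀ α (x y : NilGraphLie K G c), coord α ⁅x, y⁆ = 0) ∧
      ∀ α β (x y : NilGraphLie K G c), G.Adj α β → ⁅x, y⁆ = 0 →
        coord α x * coord β y = coord β x * coord α y := by
  obtain ⟨f, hf⟩ := NilGraphLie.exists_lift (G := G)
    (TwoStep.lowerCentralSeries_eq_bot (K := K) (G := G) hc)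
    -- A vertex goes to its indicator function; two indicators have a nonzero minor only at the pair
    -- they indicate.
    (fun α => ⟨fun β => if β = α then 1 else 0, 0⟩) (by
      intro α β h
      ext γ δ
      · simp
      · simp only [TwoStep.edge_lie, TwoStep.edge_zero]
        split_ifs <;> simp_all [G.adj_comm])
  refine ⟨fun α => { toFun := fun x => (f x).vert α, map_add' := ?_, map_smul' := ?_ }, ?_, ?_, ?_⟩
  · intro x y; simp
  · intro t x; simp
  · intro α β; simp [hf]
  · intro α x y; simp
  · intro α β x y hadj hxy
    have h1 : (⁅f x, f y⁆).edge α β = 0 := by rw [← LieHom.map_lie, hxy]; simp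
    simpa [hadj, sub_eq_zero] using h1

/-- In particular, an element with all coordinates zero is in the derived ideal. -/
theorem NilGraphLie.sub_sum_coord_mem [DecidableEq S] [Fintype S]
    {coord : S → NilGraphLie K G c →ₗ[K] K}
    (h1 : ∀ α β, coord α (nilVertex K G c β) = if α = β then 1 else 0)
    (h2 : ∀ α (x y : NilGraphLie K G c), coord α ⁅x, y⁆ = 0) (x : NilGraphLie K G c) :
    x - ∑ α, coord α x • nilVertex K G c α ∈
      ⁅(⊤ : LieIdeal K (NilGraphLie K G c)), (⊤ : LieIdeal K (NilGraphLie K G c))⁆ := by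
  induction x using NilGraphLie.induction with
  | vertex α => simp [h1]
  | zero => simp
  | add x y hx hy =>
    simp only [map_add, add_smul, Finset.sum_add_distrib]
    rw [add_sub_add_comm]; exact add_mem hx hy
  | smul t x hx =>
    simp only [map_smul, smul_assoc, ← Finset.smul_sum]
    rw [← smul_sub]; exact SMulMemClass.smul_mem t hx
  | lie x y hx hy =>
    simpa [h2] using LieSubmodule.lie_mem_lie (LieSubmodule.mem_top x) (LieSubmodule.mem_top y)

end Coordinates

/-! ### Direct sums of two ideals. -/

section Ideals

variable {K L : Type*} [CommRing K] [LieRing L] [LieAlgebra K L]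

theorem LieIdeal.lie_eq_zero_of_disjoint {I J : LieIdeal K L} (h : Disjoint I J) {x y : L}
    (hx : x ∈ I) (hy : y ∈ J) : ⁅x, y⁆ = 0 := by
  have h1 : ⁅x, y⁆ ∈ I ⊓ J :=
    LieSubmodule.mem_inf _ _ _ |>.2 ⟨lie_mem_left K L I x y hx, lie_mem_right K L J x y hy⟩
  rwa [h.eq_bot, LieSubmodule.mem_bot] at h1

/-- The projections onto the summands of a decomposition into two ideals. -/
theorem LieIdeal.exists_projections {I J : LieIdeal K L} (h : IsCompl I J) :
    ∃ p q : L →ₗ⁅K⁆ L, (∀ x, p x ∈ I) ∧ (∀ x, q x ∈ J) ∧ ∀ x, p x + q x = x := by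
  have h' : IsCompl I.toSubmodule J.toSubmodule := LieSubmodule.isCompl_toSubmodule.2 h
  have key : ∀ {I J : LieIdeal K L} (h : IsCompl I.toSubmodule J.toSubmodule) (x y : L),
      I.toSubmodule.projection _ h ⁅x, y⁆ =
        ⁅I.toSubmodule.projection _ h x, I.toSubmodule.projection _ h y⁆ := by
    intro I J h x y
    set p := I.toSubmodule.projection _ h with hp
    have hpI : ∀ x, p x ∈ I := fun x => Submodule.projection_apply_mem h x
    have hpJ : ∀ x, x - p x ∈ J := fun x => Submodule.sub_projection_mem h x
    have hd : Disjoint I J := (LieSubmodule.isCompl_toSubmodule.1 h).disjoint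
    have h1 : ⁅x, y⁆ = ⁅p x, p y⁆ + ⁅x - p x, y - p y⁆ := by
      have h2 := LieIdeal.lie_eq_zero_of_disjoint hd (hpI x) (hpJ y)
      have h3 := LieIdeal.lie_eq_zero_of_disjoint hd.symm (hpJ x) (hpI y)
      conv_lhs => rw [← add_sub_cancel (p x) x, ← add_sub_cancel (p y) y]
      rw [add_lie, lie_add, lie_add, h2, h3]
      abel
    rw [h1, map_add]
    have h4 : p ⁅p x, p y⁆ = ⁅p x, p y⁆ :=
      Submodule.projection_apply_of_mem_left h (lie_mem_left K L I _ _ (hpI x))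
    have h5 : p ⁅x - p x, y - p y⁆ = 0 :=
      (Submodule.projection_apply_eq_zero_iff h).2 (lie_mem_left K L J _ _ (hpJ x))
    rw [h4, h5, add_zero]
  refine ⟨{ I.toSubmodule.projection _ h' with map_lie' := fun {x y} => key h' x y },
    { J.toSubmodule.projection _ h'.symm with map_lie' := fun {x y} => key h'.symm x y }, ?_, ?_, ?_⟩
  · exact fun x => Submodule.projection_apply_mem h' x
  · exact fun x => Submodule.projection_apply_mem h'.symm x
  · exact fun x => Submodule.projection_add_projection_eq_self h' x

/-- In a nilpotent Lie algebra a direct summand inside the derived ideal is zero. -/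
theorem LieIdeal.eq_bot_of_isCompl_of_le {I J : LieIdeal K L} (h : IsCompl I J)
    (hI : I ≤ ⁅(⊤ : LieIdeal K L), (⊤ : LieIdeal K L)⁆) {c : ℕ}
    (hc : LieModule.lowerCentralSeries K L L c = ⊥) : I = ⊥ := by
  obtain ⟨p, q, hp, hq, hpq⟩ := LieIdeal.exists_projections h
  -- The projection `q` along `I` differs from the identity by `p`, whose values are derived; it is
  -- thus injective, yet it kills `I`.
  have hb := q.bijective_of_sub_self_mem (fun x => by
    have : q x - x = -p x := by rw [sub_eq_iff_eq_add, eq_neg_add_iff_add_eq, hpq]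
    rw [this]
    exact neg_mem (hI (hp x))) hc
  rw [eq_bot_iff]
  intro x hx
  have h1 : q x ∈ I ⊓ J := by
    refine (LieSubmodule.mem_inf _ _ _).2 ⟨?_, hq x⟩
    rw [eq_sub_of_add_eq' (hpq x)]
    exact sub_mem hx (hp x)
  rw [h.inf_eq_bot, LieSubmodule.mem_bot] at h1
  exact LieSubmodule.mem_bot _ |>.2 (hb.1 (by rw [h1, map_zero]))

end Ideals

/-! ### Restriction to unions of components. -/

section Restriction

variable {K : Type*} [CommRing K] {S : Type*} {G : SimpleGraph S} {c : ℕ}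

/-- The endomorphisms keeping the vertices of a set and killing all the others. -/
theorem NilGraphLie.exists_restrict (A : Set S) [DecidablePred (· ∈ A)] :
    ∃ e : NilGraphLie K G c →ₗ⁅K⁆ NilGraphLie K G c,
      ∀ α, e (nilVertex K G c α) = if α ∈ A then nilVertex K G c α else 0 := by
  refine NilGraphLie.exists_lift NilGraphLie.lowerCentralSeries_eq_bot _ fun α β h => ?_
  have := nilVertex_lie_eq_zero (K := K) (c := c) h
  split_ifs <;> simp [this]

/-- The images of two morphisms commute if their values at vertices commute. -/
theorem NilGraphLie.lie_eq_zero_of_vertex {L : Type*} [LieRing L] [LieAlgebra K L]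
    {f g : NilGraphLie K G c →ₗ⁅K⁆ L}
    (h : ∀ α β, ⁅f (nilVertex K G c α), g (nilVertex K G c β)⁆ = 0)
    (x y : NilGraphLie K G c) : ⁅f x, g y⁆ = 0 := by
  induction x using NilGraphLie.induction with
  | vertex α =>
    induction y using NilGraphLie.induction with
    | vertex β => exact h α β
    | zero => simp
    | add x y hx hy => rw [map_add, lie_add, hx, hy, add_zero]
    | smul t x hx => rw [map_smul, lie_smul, hx, smul_zero]
    | lie x y hx hy => rw [LieHom.map_lie, leibniz_lie, hx, hy, zero_lie, lie_zero, add_zero]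
  | zero => simp
  | add a b ha hb => rw [map_add, add_lie, ha, hb, add_zero]
  | smul t a ha => rw [map_smul, smul_lie, ha, smul_zero]
  | lie a b ha hb => rw [LieHom.map_lie, lie_lie, ha, hb, lie_zero, lie_zero, sub_zero]

/-- If no edge joins `A` to its complement, then the Lie algebra is the sum of the parts that
belong to `A` and to its complement. -/
theorem NilGraphLie.restrict_add_restrict_compl {A : Set S} [DecidablePred (· ∈ A)]
    (hA : ∀ α ∈ A, ∀ β ∉ A, ¬ G.Adj α β) {e e' : NilGraphLie K G c →ₗ⁅K⁆ NilGraphLie K G c}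
    (he : ∀ α, e (nilVertex K G c α) = if α ∈ A then nilVertex K G c α else 0)
    (he' : ∀ α, e' (nilVertex K G c α) = if α ∈ A then 0 else nilVertex K G c α)
    (x : NilGraphLie K G c) : e x + e' x = x := by
  have hcomm : ∀ x y, ⁅e x, e' y⁆ = 0 := NilGraphLie.lie_eq_zero_of_vertex fun α β => by
    rw [he, he']
    split_ifs with h1 h2
    · simp
    · exact nilVertex_lie_eq_zero (hA α h1 β h2)
    · simp
    · simp
  have hcomm' : ∀ x y, ⁅e' x, e y⁆ = 0 := fun x y => by rw [← lie_skew, hcomm, neg_zero]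
  induction x using NilGraphLie.induction with
  | vertex α => rw [he, he']; split_ifs <;> simp
  | zero => simp
  | add x y hx hy => rw [map_add, map_add, add_add_add_comm, hx, hy]
  | smul t x hx => rw [map_smul, map_smul, ← smul_add, hx]
  | lie x y hx hy =>
    conv_rhs => rw [← hx, ← hy]
    rw [add_lie, lie_add, lie_add, hcomm, hcomm', LieHom.map_lie, LieHom.map_lie]
    abel

end Restriction

/-! ### Splitting a summand that owns several components. -/

section Splitting

variable {K : Type*} [Field K] {S : Type*} {G : SimpleGraph S} {c : ℕ} [DecidableEq S]

/-- If the coordinates of `I` live on `T` and those of `J` on its complement, then a vertex of `T`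
has its component in `J` in the derived ideal. -/
theorem NilGraphLie.component_mem [Fintype S] {coord : S → NilGraphLie K G c →ₗ[K] K}
    (h1 : ∀ α β, coord α (nilVertex K G c β) = if α = β then 1 else 0)
    (h2 : ∀ α (x y : NilGraphLie K G c), coord α ⁅x, y⁆ = 0)
    {I J : LieIdeal K (NilGraphLie K G c)} {T : Set S}
    (hI : ∀ x ∈ I, ∀ α ∉ T, coord α x = 0) (hJ : ∀ x ∈ J, ∀ α ∈ T, coord α x = 0)
    {α : S} (hα : α ∈ T) {a b : NilGraphLie K G c} (ha : a ∈ I) (hb : b ∈ J)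
    (hab : a + b = nilVertex K G c α) :
    b ∈ ⁅(⊤ : LieIdeal K (NilGraphLie K G c)), (⊤ : LieIdeal K (NilGraphLie K G c))⁆ := by
  -- Off `T`, `a` contributes nothing and `β ≠ α`, so `b` has the zero coordinate of the vertex `α`.
  have h3 : ∀ β, coord β b = 0 := by
    intro β
    by_cases hβ : β ∈ T
    · exact hJ b hb β hβ
    · have h4 := h1 β α
      rw [← hab, map_add, hI a ha β hβ, if_neg (by rintro rfl; exact hβ hα), zero_add] at h4
      exact h4
  simpa [h3] using NilGraphLie.sub_sum_coord_mem h1 h2 b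

open Classical in
/-- A direct summand whose coordinates live on a union `T` of connected components is decomposable
if `T` is the disjoint union of two nonempty such unions. -/
theorem NilGraphLie.lieDecomposable_of_split [Fintype S] {coord : S → NilGraphLie K G c →ₗ[K] K}
    (h1 : ∀ α β, coord α (nilVertex K G c β) = if α = β then 1 else 0)
    (h2 : ∀ α (x y : NilGraphLie K G c), coord α ⁅x, y⁆ = 0)
    {I J : LieIdeal K (NilGraphLie K G c)} (hIJ : IsCompl I J) {T A : Set S}
    (hI : ∀ x ∈ I, ∀ α ∉ T, coord α x = 0) (hJ : ∀ x ∈ J, ∀ α ∈ T, coord α x = 0)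
    (hT : ∀ α ∈ T, ∀ β ∉ T, ¬ G.Adj α β) (hA : ∀ α ∈ A, ∀ β ∉ A, ¬ G.Adj α β)
    (hAT : A ⊆ T) (hA0 : A.Nonempty) (hTA0 : (T \ A).Nonempty) : LieDecomposable K I := by
  obtain ⟨p, q, hp, hq, hpq⟩ := LieIdeal.exists_projections hIJ
  have hpJ : ∀ x, p x = 0 → x ∈ J := fun x hx => by
    have := hpq x; rw [hx, zero_add] at this; exact this ▸ hq x
  have hqI : ∀ x, q x = 0 → x ∈ I := fun x hx => by
    have := hpq x; rw [hx, add_zero] at this; exact this ▸ hp x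
  have hdis : ∀ x ∈ I, x ∈ J → x = 0 := fun x hx hx' => by
    have h3 : x ∈ I ⊓ J := (LieSubmodule.mem_inf _ _ _).2 ⟨hx, hx'⟩
    rwa [hIJ.inf_eq_bot, LieSubmodule.mem_bot] at h3
  have hqp : ∀ x, q (p x) = 0 := fun x => hdis _
    (by rw [eq_sub_of_add_eq' (hpq (p x))]; exact sub_mem (hp x) (hp _)) (hq _)
  have hpq' : ∀ x, p (q x) = 0 := fun x => hdis _ (hp _)
    (by rw [eq_sub_of_add_eq (hpq (q x))]; exact sub_mem (hq x) (hq _))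
  -- Non-edge relations survive: within `T` or within its complement by projecting, across because
  -- `I` and `J` commute.
  obtain ⟨Φ, hΦ⟩ := NilGraphLie.exists_lift (G := G)
    (NilGraphLie.lowerCentralSeries_eq_bot (K := K) (G := G) (c := c))
    (fun α => if α ∈ T then p (nilVertex K G c α) else q (nilVertex K G c α)) (by
      intro α β h
      have h3 := nilVertex_lie_eq_zero (K := K) (c := c) h
      split_ifs
      · rw [← LieHom.map_lie, h3, map_zero]
      · exact LieIdeal.lie_eq_zero_of_disjoint hIJ.disjoint (hp _) (hq _)
      · exact LieIdeal.lie_eq_zero_of_disjoint hIJ.disjoint.symm (hq _) (hp _)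
      · rw [← LieHom.map_lie, h3, map_zero])
  have hb : Function.Bijective Φ := by
    refine Φ.bijective_of_sub_self_mem (NilGraphLie.sub_self_mem Φ fun α => ?_)
      NilGraphLie.lowerCentralSeries_eq_bot
    rw [hΦ]
    have h3 := hpq (nilVertex K G c α)
    split_ifs with hα
    · rw [show p (nilVertex K G c α) - nilVertex K G c α = -q (nilVertex K G c α) by
        rw [sub_eq_iff_eq_add, eq_neg_add_iff_add_eq, add_comm, h3]]
      exact neg_mem (NilGraphLie.component_mem h1 h2 hI hJ hα (hp _) (hq _) h3)
    · rw [show q (nilVertex K G c α) - nilVertex K G c α = -p (nilVertex K G c α) by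
        rw [sub_eq_iff_eq_add, eq_neg_add_iff_add_eq, h3]]
      exact neg_mem (NilGraphLie.component_mem (T := Tᶜ) h1 h2
        (fun x hx α hα => hJ x hx α (not_not.1 hα)) hI hα (hq _) (hp _) (by rw [add_comm, h3]))
  let Ψ := LieEquiv.ofBijective Φ hb
  have hΦΨ : ∀ x, Φ (Ψ.symm x) = x := fun x => Ψ.apply_symm_apply x
  have hΨΦ : ∀ x, Ψ.symm (Φ x) = x := fun x => Ψ.symm_apply_apply x
  choose e he using fun A : Set S => NilGraphLie.exists_restrict (K := K) (G := G) (c := c) A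
  have hee : ∀ (A B : Set S) x, e A (e B x) = e (A ∩ B) x := by
    intro A B
    refine NilGraphLie.hom_ext (f := (e A).comp (e B)) fun α => ?_
    rw [LieHom.comp_apply, he, he]
    by_cases hB : α ∈ B <;> by_cases hA : α ∈ A <;> simp [he, hA, hB]
  have he0 : ∀ x, e ∅ x = 0 :=
    NilGraphLie.hom_ext (g := (0 : NilGraphLie K G c →ₗ⁅K⁆ NilGraphLie K G c)) fun α => by
      simp [he]
  have hadd : ∀ A : Set S, (∀ α ∈ A, ∀ β ∉ A, ¬ G.Adj α β) → ∀ x, e A x + e Aᶜ x = x :=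
    fun A hA => NilGraphLie.restrict_add_restrict_compl hA (he A) fun α => by simp [he, ite_not]
  have hΦI : ∀ A ⊆ T, ∀ x, Φ (e A x) ∈ I := fun A hA x => hqI _ <|
    NilGraphLie.hom_ext (f := (q.comp Φ).comp (e A))
      (g := (0 : NilGraphLie K G c →ₗ⁅K⁆ NilGraphLie K G c)) (fun α => by
        by_cases hα : α ∈ A <;> simp [he, hα, hΦ, hqp, hA _]) x
  have hΦJ : ∀ x, Φ (e Tᶜ x) ∈ J := fun x => hpJ _ <|
    NilGraphLie.hom_ext (f := (p.comp Φ).comp (e Tᶜ))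
      (g := (0 : NilGraphLie K G c →ₗ⁅K⁆ NilGraphLie K G c)) (fun α => by
        by_cases hα : α ∈ T <;> simp [he, hα, hΦ, hpq']) x
  have hvne : ∀ α, nilVertex K G c α ≠ 0 := fun α h0 => by
    have := h1 α α; simp [h0] at this
  -- Elements of `I` whose preimage under `Φ` has no part outside `B`; as a kernel this is
  -- automatically an ideal.
  let X : Set S → LieIdeal K I := fun B =>
    (((e Bᶜ).comp (Ψ.symm : NilGraphLie K G c →ₗ⁅K⁆ NilGraphLie K G c)).comp
      (LieIdeal.incl I)).ker
  have hX : ∀ B (x : I), x ∈ X B ↔ e Bᶜ (Ψ.symm (x : NilGraphLie K G c)) = 0 := fun B x =>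
    LieHom.mem_ker
  have hXne : ∀ B ⊆ T, B.Nonempty → X B ≠ ⊥ := by
    rintro B hB ⟨α, hα⟩ hbot
    have h3 : Φ (nilVertex K G c α) ∈ I := by
      have := hΦI B hB (nilVertex K G c α)
      rwa [he, if_pos hα] at this
    have h4 : (⟨_, h3⟩ : I) ∈ X B := by
      rw [hX, hΨΦ, he, if_neg (fun h => h hα)]
    rw [hbot, LieSubmodule.mem_bot] at h4
    have h5 : Φ (nilVertex K G c α) = 0 := congrArg Subtype.val h4
    exact hvne α (hb.1 (by rw [h5, map_zero]))
  refine ⟨X A, X (T \ A), hXne A hAT hA0, hXne _ Set.sdiff_subset hTA0, ?_, ?_⟩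
  · rw [disjoint_iff, eq_bot_iff]
    intro x hx
    obtain ⟨hx1, hx2⟩ := (LieSubmodule.mem_inf _ _ _).1 hx
    rw [hX] at hx1 hx2
    have h3 := congrArg (e A) hx2
    rw [hee, map_zero, Set.inter_eq_left.2 (fun α hα h => h.2 hα)] at h3
    have h4 := hadd A hA (Ψ.symm (x : NilGraphLie K G c))
    rw [hx1, h3, add_zero] at h4
    have h5 := hΦΨ (x : NilGraphLie K G c)
    rw [← h4, map_zero] at h5
    exact (LieSubmodule.mem_bot _).2 (Subtype.ext h5.symm)
  · rw [codisjoint_iff, eq_top_iff]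
    rintro ⟨w, hw⟩ -
    set z := Ψ.symm w with hz
    have h3 : z = e A z + e (T \ A) z + e Tᶜ z := by
      conv_lhs => rw [← hadd T hT z, ← hadd A hA (e T z), hee, hee, Set.inter_eq_left.2 hAT,
        Set.inter_comm, ← Set.sdiff_eq]
    have h4 : w = Φ (e A z) + Φ (e (T \ A) z) + Φ (e Tᶜ z) := by
      rw [← map_add, ← map_add, ← h3, hz, hΦΨ]
    -- This term is in `J`, and also in `I` as a difference of elements of `I`.
    have h5 : Φ (e Tᶜ z) = 0 := by
      refine hdis _ ?_ (hΦJ z)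
      rw [eq_sub_of_add_eq' h4.symm]
      exact sub_mem hw (add_mem (hΦI _ hAT _) (hΦI _ Set.sdiff_subset _))
    rw [h5, add_zero] at h4
    refine (LieSubmodule.mem_sup _ _ _).2
      ⟨⟨_, hΦI _ hAT z⟩, ?_, ⟨_, hΦI _ Set.sdiff_subset z⟩, ?_, Subtype.ext h4.symm⟩
    · rw [hX, hΨΦ, hee, Set.compl_inter_self, he0]
    · rw [hX, hΨΦ, hee, Set.compl_inter_self, he0]

end Splitting

/-! ### Matching summands with components. -/

section Decomposition

variable {K : Type*} [Field K] {S : Type*} {G : SimpleGraph S} {c : ℕ}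

open Classical in
/-- The ideals of a direct decomposition are supported on disjoint unions of connected components:
every vertex belongs to exactly one of them. -/
theorem NilGraphLie.exists_support (hG : ∀ α, ∃ β, G.Adj α β)
    {coord : S → NilGraphLie K G c →ₗ[K] K}
    (h1 : ∀ α β, coord α (nilVertex K G c β) = if α = β then 1 else 0)
    (h3 : ∀ α β (x y : NilGraphLie K G c), G.Adj α β → ⁅x, y⁆ = 0 →
      coord α x * coord β y = coord β x * coord α y)
    {ι : Type*} {h : ι → LieIdeal K (NilGraphLie K G c)}
    (hdis : ∀ i j, i ≠ j → Disjoint (h i) (h j)) (htop : ⨆ i, (h i).toSubmodule = ⊤) :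
    ∃ f : S → ι, (∀ α β, G.Adj α β → f α = f β) ∧
      ∀ i, ∀ x ∈ h i, ∀ α, f α ≠ i → coord α x = 0 := by
  have hind : ∀ N : Submodule K (NilGraphLie K G c), (∀ i, ∀ x ∈ h i, x ∈ N) → ∀ x, x ∈ N := by
    intro N hN x
    have h4 : (⊤ : Submodule K (NilGraphLie K G c)) ≤ N := htop ▸ iSup_le fun i x hx => hN i x hx
    exact h4 Submodule.mem_top
  have hex : ∀ α, ∃ i, ∃ x ∈ h i, coord α x ≠ 0 := by
    intro α
    by_contra! hcon
    have := hind (LinearMap.ker (coord α)) (fun i x hx => LinearMap.mem_ker.2 (hcon i x hx))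
      (nilVertex K G c α)
    rw [LinearMap.mem_ker, h1, if_pos rfl] at this
    exact one_ne_zero this
  have key : ∀ α β i j, G.Adj α β → i ≠ j → ∀ x ∈ h i, ∀ y ∈ h j, coord α x ≠ 0 →
      coord α y = 0 ∧ coord β y = 0 := by
    intro α β i j hαβ hij x hx y hy hx0
    have hcomm : ∀ i j, i ≠ j → ∀ x ∈ h i, ∀ y ∈ h j,
        coord α x * coord β y = coord β x * coord α y := fun i j hij x hx y hy =>
      h3 α β x y hαβ (LieIdeal.lie_eq_zero_of_disjoint (hdis i j hij) hx hy)
    have hxy := hcomm i j hij x hx y hy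
    suffices hy0 : coord α y = 0 by
      refine ⟨hy0, ?_⟩
      rw [hy0, mul_zero] at hxy
      exact (mul_eq_zero.1 hxy).resolve_left hx0
    by_contra hy0
    -- If both `x` and `y` are visible at `α`, every summand has the ratio of `x` at this edge:
    -- compare with `x`, or with `y` for the summand of `x` itself. The vertex `β` violates this
    -- ratio.
    have h5 : ∀ z, z ∈ LinearMap.ker (coord α x • coord β - coord β x • coord α) := by
      refine hind _ fun m z hz => ?_
      simp only [LinearMap.mem_ker, LinearMap.sub_apply, LinearMap.smul_apply, smul_eq_mul,
        sub_eq_zero]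
      by_cases hm : i = m
      · subst hm
        have hzy := hcomm i j hij z hz y hy
        apply mul_right_cancel₀ hy0
        linear_combination coord α z * hxy - coord α x * hzy
      · exact hcomm i m hm x hx z hz
    have h6 := h5 (nilVertex K G c β)
    simp only [LinearMap.mem_ker, LinearMap.sub_apply, LinearMap.smul_apply, smul_eq_mul,
      h1, if_neg hαβ.ne, mul_zero, sub_zero, if_true, mul_one] at h6
    exact hx0 h6
  choose f x hx hx0 using hex
  refine ⟨f, fun α β hαβ => ?_, fun i y hy α hα => ?_⟩
  · by_contra hne
    exact hx0 β (key α β _ _ hαβ hne _ (hx α) _ (hx β) (hx0 α)).2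
  -- The absence of isolated vertices is needed here: `key` requires an edge at `α`.
  · obtain ⟨β, hβ⟩ := hG α
    exact (key α β _ _ hβ hα _ (hx α) _ hy (hx0 α)).1

/-- A decomposition into indecomposable ideals corresponds to the connected components, over any
field. -/
theorem NilGraphLie.decomposition_unique [Fintype S] (hG : ∀ α, ∃ β, G.Adj α β) (hc : 1 < c)
    {ι : Type*} (h : ι → LieIdeal K (NilGraphLie K G c)) (hne : ∀ i, h i ≠ ⊥)
    (hind : ∀ i, ¬ LieDecomposable K (h i))
    (hindep : iSupIndep h) (htop : ⨆ i, h i = ⊤) :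
    ∃ C : ι ≃ G.ConnectedComponent, ∀ i,
        (h i).toSubmodule.map (abProj K (NilGraphLie K G c)) =
          (nilVertexSpan K G c (C i).supp).map (abProj K (NilGraphLie K G c)) := by
  classical
  obtain ⟨coord, h1, h2, h3⟩ := NilGraphLie.exists_coord (K := K) (G := G) hc
  obtain ⟨f, hf, hsupp⟩ := NilGraphLie.exists_support hG h1 h3
    (fun i j hij => hindep.pairwiseDisjoint hij)
    (by rw [← LieSubmodule.iSup_toSubmodule, htop, LieSubmodule.top_toSubmodule])
  have hcompl : ∀ i, IsCompl (h i) (⨆ (j) (_ : j ≠ i), h j) := fun i =>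
    ⟨hindep i, by
      rw [codisjoint_iff, eq_top_iff, ← htop]
      refine iSup_le fun j => ?_
      by_cases hj : j = i
      · subst hj; exact le_sup_left
      · exact le_sup_of_le_right (le_iSup₂ (f := fun j (_ : j ≠ i) => h j) j hj)⟩
  have hsupp' : ∀ i, ∀ x ∈ (⨆ (j) (_ : j ≠ i), h j : LieIdeal K (NilGraphLie K G c)), ∀ α,
      f α = i → coord α x = 0 := by
    intro i x hx α hα
    have h4 : (⨆ (j) (_ : j ≠ i), h j : LieIdeal K (NilGraphLie K G c)).toSubmodule ≤
        LinearMap.ker (coord α) := by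
      simp only [LieSubmodule.iSup_toSubmodule]
      refine iSup₂_le fun j hj y hy => LinearMap.mem_ker.2 (hsupp j y hy α ?_)
      rw [hα]; exact hj.symm
    exact LinearMap.mem_ker.1 (h4 hx)
  have hreach : ∀ α β, G.Reachable α β → f α = f β := by
    rintro α β ⟨w⟩
    induction w with
    | nil => rfl
    | cons hadj _ ih => exact (hf _ _ hadj).trans ih
  let F : G.ConnectedComponent → ι :=
    fun C => C.lift f (fun α β w _ => hreach α β w.reachable)
  have hF : ∀ α, F (G.connectedComponentMk α) = f α := fun α => rfl
  have hsurj : Function.Surjective F := by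
    intro i
    by_contra! hcon
    refine hne i (LieIdeal.eq_bot_of_isCompl_of_le (hcompl i) (fun x hx => ?_)
      NilGraphLie.lowerCentralSeries_eq_bot)
    have h4 : ∀ α, coord α x = 0 := fun α => hsupp i x hx α (hcon (G.connectedComponentMk α))
    simpa [h4] using NilGraphLie.sub_sum_coord_mem h1 h2 x
  have hinj : Function.Injective F := by
    intro C D hCD
    by_contra hne'
    -- `T` collects all vertices owned by `F C`; it contains `C` and, disjointly, `D`.
    refine hind (F C) (NilGraphLie.lieDecomposable_of_split h1 h2 (hcompl (F C))
      (T := {α | f α = F C}) (A := C.supp)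
      (fun x hx α hα => hsupp _ x hx α hα) (fun x hx α hα => hsupp' _ x hx α hα)
      (fun α hα β hβ hadj => hβ ((hf α β hadj).symm.trans hα))
      (fun α hα β hβ hadj => hβ ((SimpleGraph.ConnectedComponent.sound hadj.reachable).symm.trans hα))
      (fun α hα => by
        rw [SimpleGraph.ConnectedComponent.mem_supp_iff] at hα
        subst hα; exact hF α) C.nonempty_supp ?_)
    obtain ⟨β, hβ⟩ := D.nonempty_supp
    rw [SimpleGraph.ConnectedComponent.mem_supp_iff] at hβ
    refine ⟨β, ?_, fun hβ' => hne' ?_⟩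
    · rw [Set.mem_ofPred_eq, hCD, ← hβ]; rfl
    · rw [SimpleGraph.ConnectedComponent.mem_supp_iff] at hβ'
      rw [← hβ', hβ]
  let E := Equiv.ofBijective F ⟨hinj, hsurj⟩
  refine ⟨E.symm, fun i => ?_⟩
  have hmem : ∀ α, α ∈ (E.symm i).supp ↔ f α = i := fun α => by
    rw [SimpleGraph.ConnectedComponent.mem_supp_iff, Equiv.eq_symm_apply]; rfl
  have hab : ∀ x y : NilGraphLie K G c, x - y ∈
      ⁅(⊤ : LieIdeal K (NilGraphLie K G c)), (⊤ : LieIdeal K (NilGraphLie K G c))⁆ →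
      abProj K (NilGraphLie K G c) x = abProj K (NilGraphLie K G c) y := fun x y hxy => by
    rw [← sub_eq_zero, ← map_sub]
    exact LieSubmodule.Quotient.mk_eq_zero'.2 hxy
  apply le_antisymm
  · rintro _ ⟨x, hx, rfl⟩
    refine ⟨∑ α, coord α x • nilVertex K G c α, Submodule.sum_mem _ fun α _ => ?_,
      (hab _ _ (NilGraphLie.sub_sum_coord_mem h1 h2 x)).symm⟩
    by_cases hα : f α = i
    · exact Submodule.smul_mem _ _ (Submodule.subset_span ⟨α, (hmem α).2 hα, rfl⟩)
    · rw [hsupp i x hx α hα, zero_smul]; exact Submodule.zero_mem _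
  · rw [nilVertexSpan, Submodule.map_span, Submodule.span_le]
    rintro _ ⟨_, ⟨α, hα, rfl⟩, rfl⟩
    -- Modulo the derived ideal, a vertex equals its component in the summand that owns it.
    obtain ⟨p, q, hp, hq, hpq⟩ := LieIdeal.exists_projections (hcompl i)
    have h4 := NilGraphLie.component_mem (T := {α | f α = i}) h1 h2
      (fun x hx α hα => hsupp i x hx α hα) (fun x hx α hα => hsupp' i x hx α hα)
      ((hmem α).1 hα) (hp _) (hq _) (hpq _)
    refine ⟨p (nilVertex K G c α), hp _, (hab _ _ ?_).symm⟩
    rwa [← eq_sub_of_add_eq' (hpq (nilVertex K G c α))]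

end Decomposition

theorem mainTheorem8 {S : Type*} [Fintype S] (G : SimpleGraph S) [DecidableRel G.Adj]
    (hG : ∀ α : S, G.degree α ≠ 0)
    (K : Subfield ℂ) (c : ℕ) (hc : 1 < c)
    (k : ℕ) (h : Fin k → LieIdeal K (NilGraphLie K G c))
    (hne : ∀ i, h i ≠ ⊥)
    (hind : ∀ i, ¬ LieDecomposable K (h i))
    (hsum : DirectSum.IsInternal (fun i => (h i).toSubmodule)) :
    k = Nat.card G.ConnectedComponent ∧
      ∃ C : Fin k ≃ G.ConnectedComponent, ∀ i,
        (h i).toSubmodule.map (abProj K (NilGraphLie K G c)) =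
          (nilVertexSpan K G c (C i).supp).map (abProj K (NilGraphLie K G c)) := by
  obtain ⟨C, hC⟩ := NilGraphLie.decomposition_unique
    (fun α => (G.degree_pos_iff_exists_adj α).1 (Nat.pos_of_ne_zero (hG α))) hc h hne hind
    (LieSubmodule.iSupIndep_toSubmodule.1 hsum.submodule_iSupIndep)
    (LieSubmodule.iSup_toSubmodule_eq_top.1 hsum.submodule_iSup_eq_top)
  exact ⟨by rw [← Nat.card_congr C, Nat.card_fin], C, hC⟩
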